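/- Throughout, "definable" means definable with parameters in the given structure $\mathcal M$, $|x|=\max_i|x_i|$ on $M^n$, and topological notions refer to the order topology on $M$ and the product topology on $M^n$. Let $\mathcal M=(M,<,0,+,\ldots)$ be an expansion of an ordered group such that: (i) $\mathcal M$ is definably complete: every definable $X\subseteq M$ has a supremum and an infimum in $M\cup\{\pm\infty\}$; (ii) $\mathcal M$ is locally o-minimal: for every definable $X\subseteq M$ and every $a\in M$ there is an open interval $I\ni a$ such that $X\cap I$ is a finite union of points and open intervals; (iii) $\mathcal M$ has definable bounded multiplication: there are $1\in M$ and $\cdot:M\times M\to M$, fixed in what follows, such that $(M,<,0,1,+,\cdot)$ is an ordered field and, for every bounded open interval $I$, the restriction of $\cdot$ to $I\times I$ is definable. Let $\Phi_0(M)$ be the group, under composition, of all odd strictly increasing definable bijections $M\to M$ fixing $0$. Let $\Phi\subseteq\Phi_0(M)$ be a subgroup such that, for every $a>0$ in $M$ and every definable continuous strictly increasing function $u:[0,a]\to M$ with $u(0)=0$, there are $\varphi,\psi\in\Phi$ with $u(t)\le\varphi(t)$ and $\psi(t)\le u(t)$ for all sufficiently small $t>0$. Let $S\subseteq M^n$ be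 definable, closed and bounded, and let $f,g:S\to M$ be definable continuous functions with $f^{-1}(0)\subseteq g^{-1}(0)$. Then there exist $\phi\in\Phi$ and a definable continuous function $h:S\to M$ such that $\phi(g(x))=h(x)f(x)$ for all $x\in S$. Moreover, suppose that $\mathcal M$ is polynomially bounded, i.e. for every $a>0$ in $M$ and every definable continuous strictly increasing $u:[0,a]\to M$ with $u(0)=0$ there is a positive integer $m$ with $u(t)\ge t^m$ for all sufficiently small $t>0$. Then there exist a positive integer $m$ and a definable continuous function $h:S\to M$ such that $g(x)^m=h(x)f(x)$ for all $x\in S$. -/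

import Mathlib

open Set Filter Topology

universe u v w

namespace BddMul

/-- Definable, with arbitrary parameters from `M`, as a subset of `M ^ α`. -/
abbrev Def (L : FirstOrder.Language.{u, v}) {M : Type w} [L.Structure M] {α : Type}
    (X : Set (α → M)) : Prop :=
  (Set.univ : Set M).Definable L X

/-- Definable (with parameters) subsets of `M`. -/
abbrev Def₁ (L : FirstOrder.Language.{u, v}) {M : Type w} [L.Structure M] (X : Set M) : Prop :=
  (Set.univ : Set M).Definable₁ L X

/-- Definable (with parameters) subsets of `M × M`. -/
abbrev Def₂ (L : FirstOrder.Language.{u, v}) {M : Type w} [L.Structure M]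
    (X : Set (M × M)) : Prop :=
  (Set.univ : Set M).Definable₂ L X

/-- The restriction of `f` to `S ⊆ M ^ α` is a definable function `S → M`: its graph
`{(x, f x) | x ∈ S}` is definable (coordinate `none` carries the value). For `S = univ` this is
`Set.DefinableFun`. -/
def DefFunOn (L : FirstOrder.Language.{u, v}) {M : Type w} [L.Structure M] {α : Type}
    (S : Set (α → M)) (f : (α → M) → M) : Prop :=
  Def L {p : Option α → M | (fun i => p (some i)) ∈ S ∧ f (fun i => p (some i)) = p none}

/-- The restriction of the unary function `f` to `s ⊆ M` is a definable function `s → M`. -/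
def DefFunOn₁ (L : FirstOrder.Language.{u, v}) {M : Type w} [L.Structure M]
    (s : Set M) (f : M → M) : Prop :=
  Def₂ L {p : M × M | p.1 ∈ s ∧ f p.1 = p.2}

/-- The `L`-structure `M` is an expansion of `(M, <, 0, +)`: order and addition are definable. -/
structure ExpandsOrderedGroup (L : FirstOrder.Language.{u, v}) (M : Type w) [L.Structure M]
    [Field M] [LinearOrder M] : Prop where
  lt_def : Def₂ L {p : M × M | p.1 < p.2}
  add_def : Def L {p : Fin 3 → M | p 0 + p 1 = p 2}

/-- The product of the ordered field `M`, restricted to `I × I`, is definable for every bounded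
open interval `I = (a, b)`. -/
def HasDefinableBoundedMul (L : FirstOrder.Language.{u, v}) (M : Type w) [L.Structure M]
    [Field M] [LinearOrder M] : Prop :=
  ∀ a b : M, Def L {p : Fin 3 → M | p 0 ∈ Ioo a b ∧ p 1 ∈ Ioo a b ∧ p 0 * p 1 = p 2}

/-- Every definable subset of `M` has a supremum and an infimum in `M ∪ {±∞}`. -/
def DefinablyComplete (L : FirstOrder.Language.{u, v}) (M : Type w) [L.Structure M]
    [LinearOrder M] : Prop :=
  ∀ X : Set M, Def₁ L X → X.Nonempty →
    (BddAbove X → ∃ s, IsLUB X s) ∧ (BddBelow X → ∃ s, IsGLB X s)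

/-- Around every point `a`, a definable `X ⊆ M` is a finite union of points and open intervals. -/
def LocallyOMinimal (L : FirstOrder.Language.{u, v}) (M : Type w) [L.Structure M]
    [LinearOrder M] : Prop :=
  ∀ X : Set M, Def₁ L X → ∀ a : M, ∃ c d : M, a ∈ Ioo c d ∧
    ∃ (P : Set M) (J : Set (M × M)), P.Finite ∧ J.Finite ∧
      X ∩ Ioo c d = P ∪ ⋃ q ∈ J, Ioo q.1 q.2

/-- `f` restricts to a definable continuous strictly increasing function `[0, a] → M` with
`f 0 = 0`. -/
structure IsDefIncreasingGerm (L : FirstOrder.Language.{u, v}) {M : Type w} [L.Structure M]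
    [Field M] [LinearOrder M] [TopologicalSpace M] (a : M) (f : M → M) : Prop where
  definable : DefFunOn₁ L (Icc 0 a) f
  continuousOn : ContinuousOn f (Icc 0 a)
  strictMonoOn : StrictMonoOn f (Icc 0 a)
  map_zero : f 0 = 0

/-- The set `Φ₀(M)` of odd strictly increasing definable bijections of `M` fixing the origin. -/
def Phi₀ (L : FirstOrder.Language.{u, v}) (M : Type w) [L.Structure M]
    [Field M] [LinearOrder M] : Set (Equiv.Perm M) :=
  {φ | (∀ t, φ (-t) = -φ t) ∧ StrictMono φ ∧ φ 0 = 0 ∧ DefFunOn₁ L univ φ}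

/-- `Φ` is a subgroup (under composition) of `Φ₀(M)` whose elements bound, from above and from
below near `0`, every definable continuous strictly increasing `f : [0, a] → M` with `f 0 = 0`. -/
structure IsAdmissible (L : FirstOrder.Language.{u, v}) {M : Type w} [L.Structure M]
    [Field M] [LinearOrder M] [TopologicalSpace M] (Φ : Subgroup (Equiv.Perm M)) : Prop where
  subset : (Φ : Set (Equiv.Perm M)) ⊆ Phi₀ L M
  bounds : ∀ a : M, 0 < a → ∀ f : M → M, IsDefIncreasingGerm L a f →
    ∃ φ ∈ Φ, ∃ ψ ∈ Φ, (∀ᶠ t in 𝓝[>] (0 : M), f t ≤ φ t) ∧ (∀ᶠ t in 𝓝[>] (0 : M), ψ t ≤ f t)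

/-- Polynomial boundedness. -/
def PolynomiallyBounded (L : FirstOrder.Language.{u, v}) (M : Type w) [L.Structure M]
    [Field M] [LinearOrder M] [TopologicalSpace M] : Prop :=
  ∀ a : M, 0 < a → ∀ f : M → M, IsDefIncreasingGerm L a f →
    ∃ m : ℕ, 0 < m ∧ ∀ᶠ t in 𝓝[>] (0 : M), t ^ m ≤ f t

end BddMul

/-! For `t ≥ 0` put `v t = inf_{x ∈ S} max |f x| (t - |g x|)`. As an infimum of increasing
`1`-Lipschitz functions of `t`, `v` is increasing and continuous, and `t = |g x|` gives `v |g x| ≤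
|f x|`. For `t > 0` the function under the infimum is positive on `S`, because `f x = 0` forces `g x
= 0`; definable compactness then gives `v t > 0`. Hence `u t = t * v t` is an increasing germ with
`u |g x| ≤ |g x| * |f x|` (`exists_germ`).

Some `φ ∈ Φ`, or a power `t ^ m` in the polynomially bounded case, lies below `u` near `0`. So `k =
φ ∘ g`, or `k = g ^ m`, satisfies `|k| ≤ |g| * |f|` where `|g|` is small, and `k / f`, set to `0` on
the zeros of `f`, is continuous (`exists_quotient`). Only bounded multiplication is definable, so
each product or quotient needs a bound on its factors before it can be called definable. -/

namespace BddMul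

/-! ### Closure properties of definable sets and functions. -/

section Definability

variable {L : FirstOrder.Language.{u, v}} {M : Type w} [L.Structure M] {α : Type}

theorem Def.and {P Q : (α → M) → Prop} (hP : Def L {v | P v}) (hQ : Def L {v | Q v}) :
    Def L {v | P v ∧ Q v} :=
  hP.inter hQ

theorem Def.or {P Q : (α → M) → Prop} (hP : Def L {v | P v}) (hQ : Def L {v | Q v}) :
    Def L {v | P v ∨ Q v} :=
  hP.union hQ

theorem Def.not {P : (α → M) → Prop} (hP : Def L {v | P v}) : Def L {v | ¬ P v} :=
  hP.compl

theorem Def.imp {P Q : (α → M) → Prop} (hP : Def L {v | P v}) (hQ : Def L {v | Q v}) :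
    Def L {v | P v → Q v} := by
  simpa only [imp_iff_not_or] using hP.not.or hQ

theorem Def.of_prop (c : Prop) : Def L {_v : α → M | c} := by
  by_cases h : c
  · simp [h]
  · simp [h]

theorem Def.forall_finite {ι : Type} [Finite ι] {P : ι → (α → M) → Prop}
    (h : ∀ i, Def L {v | P i v}) : Def L {v | ∀ i, P i v} := by
  simpa only [ofPred_forall] using! definable_iInter_of_finite h

/-- Definability is preserved by existential quantification over tuples. -/
theorem Def.exists_tuple {β : Type} [Finite β] {P : (α → M) → (β → M) → Prop}
    (h : Def L {p : α ⊕ β → M | P (fun i => p (.inl i)) (fun i => p (.inr i))}) :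
    Def L {v | ∃ x, P v x} := by
  simpa using! Definable.exists_of_finite h

/-- Definability is preserved by universal quantification over tuples. -/
theorem Def.forall_tuple {β : Type} [Finite β] {P : (α → M) → (β → M) → Prop}
    (h : Def L {p : α ⊕ β → M | P (fun i => p (.inl i)) (fun i => p (.inr i))}) :
    Def L {v | ∀ x, P v x} := by
  simpa using! Definable.forall_of_finite h

/-- Definability is preserved by universal quantification over elements. -/
theorem Def.forall_elem {P : (α → M) → M → Prop}
    (h : Def L {p : α ⊕ Unit → M | P (fun i => p (.inl i)) (p (.inr ()))}) :
    Def L {v | ∀ x, P v x} := by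
  have := Def.forall_tuple (P := fun v (x : Unit → M) => P v (x ())) h
  convert this using 3
  exact ⟨fun h x => h (x ()), fun h x => h fun _ => x⟩

/-- The total function `f` on `M ^ α` is definable with parameters. -/
abbrev DefFun (L : FirstOrder.Language.{u, v}) {M : Type w} [L.Structure M] {α : Type}
    (f : (α → M) → M) : Prop :=
  (Set.univ : Set M).DefinableFun L f

theorem DefFun.of_graph {f : (α → M) → M}
    (h : Def L {p : Option α → M | f (fun i => p (some i)) = p none}) : DefFun L f := by
  simpa [DefinableFun, Function.tupleGraph] using! h

theorem DefFun.graph {f : (α → M) → M} (h : DefFun L f) :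
    Def L {p : Option α → M | f (fun i => p (some i)) = p none} := by
  simpa [DefinableFun, Function.tupleGraph] using! h

theorem DefFun.const (a : M) : DefFun L (fun _ : α → M => a) :=
  L.definableFun_const α (mem_univ a)

theorem DefFun.proj (i : α) : DefFun L (fun v : α → M => v i) :=
  DefinableFun.proj L

theorem DefFun.comp {β : Type} [Finite β] {f : (β → M) → M} (hf : DefFun L f)
    {g : β → (α → M) → M} (hg : ∀ b, DefFun L (g b)) : DefFun L fun v => f fun b => g b v :=
  DefinableFun.comp (g := fun v b => g b v) hg hf

theorem Def.comp {β : Type} [Finite β] {X : Set (β → M)} (hX : Def L X)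
    {g : β → (α → M) → M} (hg : ∀ b, DefFun L (g b)) : Def L {v | (fun b => g b v) ∈ X} :=
  Definable.preimage_map (F := fun v b => g b v) hg hX

theorem DefFun.eq {f g : (α → M) → M} (hf : DefFun L f) (hg : DefFun L g) :
    Def L {v | f v = g v} :=
  hf.ofPred_eq hg

theorem DefFun.ite {p : (α → M) → Prop} [DecidablePred p] {f g : (α → M) → M}
    (hp : Def L {v | p v}) (hf : DefFun L f) (hg : DefFun L g) :
    DefFun L fun v => if p v then f v else g v :=
  DefinableFun.ite hp hf hg

theorem DefFun.defFunOn {f : (α → M) → M} (hf : DefFun L f) {S : Set (α → M)} (hS : Def L S) :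
    DefFunOn L S f :=
  Def.and (hS.preimage_comp some) hf.graph

/-- A function definable on a definable set agrees there with a totally defined one. -/
theorem DefFunOn.exists_defFun [Zero M] {S : Set (α → M)} (hS : Def L S) {f : (α → M) → M}
    (hf : DefFunOn L S f) : ∃ F : (α → M) → M, DefFun L F ∧ EqOn F f S := by
  classical
  -- Extension by zero makes the composition rules for total functions available.
  refine ⟨fun x => if x ∈ S then f x else 0, .of_graph ?_, fun x hx => if_pos hx⟩
  have h2 : Def L {p : Option α → M | (fun i => p (some i)) ∉ S ∧ 0 = p none} :=
    (Def.not (hS.preimage_comp some)).and ((DefFun.const 0).eq (.proj none))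
  convert hf.union h2 using 1
  ext p
  by_cases h : (fun i => p (some i)) ∈ S <;> simp [h]

theorem DefFunOn.congr {S : Set (α → M)} {f g : (α → M) → M} (hf : DefFunOn L S f)
    (h : EqOn f g S) : DefFunOn L S g := by
  unfold DefFunOn at *
  convert hf using 3 with p
  exact and_congr_right fun hp => by rw [h hp]

theorem DefFunOn₁.defFun {φ : M → M} (hφ : DefFunOn₁ L univ φ) {α : Type} {f : (α → M) → M}
    (hf : DefFun L f) : DefFun L fun v => φ (f v) := by
  refine DefFun.comp (f := fun x : Unit → M => φ (x ())) (g := fun _ => f) (.of_graph ?_)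
    fun _ => hf
  simpa using! hφ.preimage_comp ![some (), none]

section Order

variable [Field M] [LinearOrder M]

theorem ExpandsOrderedGroup.lt (hexp : ExpandsOrderedGroup L M) {f g : (α → M) → M}
    (hf : DefFun L f) (hg : DefFun L g) : Def L {v | f v < g v} := by
  have := Def.comp (g := ![f, g]) hexp.lt_def (by simp [Fin.forall_fin_two, hf, hg])
  simpa using! this

theorem ExpandsOrderedGroup.le (hexp : ExpandsOrderedGroup L M) {f g : (α → M) → M}
    (hf : DefFun L f) (hg : DefFun L g) : Def L {v | f v ≤ g v} := by
  simpa only [not_lt] using (hexp.lt hg hf).not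

theorem ExpandsOrderedGroup.add (hexp : ExpandsOrderedGroup L M) {f g : (α → M) → M}
    (hf : DefFun L f) (hg : DefFun L g) : DefFun L fun v => f v + g v := by
  refine DefFun.comp (f := fun x : Fin 2 → M => x 0 + x 1) (g := ![f, g]) (.of_graph ?_)
    (by simp [Fin.forall_fin_two, hf, hg])
  exact hexp.add_def.preimage_comp ![some 0, some 1, none]

theorem ExpandsOrderedGroup.neg (hexp : ExpandsOrderedGroup L M) {f : (α → M) → M}
    (hf : DefFun L f) : DefFun L fun v => - f v := by
  refine DefFun.comp (f := fun x : Unit → M => - x ()) (g := fun _ => f) (.of_graph ?_)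
    fun _ => hf
  convert (hexp.add (.proj (some ())) (.proj none)).eq (L := L) (.const 0) using 3 with p
  exact neg_eq_iff_add_eq_zero

theorem ExpandsOrderedGroup.sub (hexp : ExpandsOrderedGroup L M) {f g : (α → M) → M}
    (hf : DefFun L f) (hg : DefFun L g) : DefFun L fun v => f v - g v := by
  simpa only [sub_eq_add_neg] using hexp.add hf (hexp.neg hg)

theorem ExpandsOrderedGroup.max (hexp : ExpandsOrderedGroup L M) {f g : (α → M) → M}
    (hf : DefFun L f) (hg : DefFun L g) : DefFun L fun v => max (f v) (g v) := by
  simpa only [max_def] using DefFun.ite (hexp.le hf hg) hg hf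

theorem ExpandsOrderedGroup.abs (hexp : ExpandsOrderedGroup L M) {f : (α → M) → M}
    (hf : DefFun L f) : DefFun L fun v => |f v| :=
  hexp.max hf (hexp.neg hf)

/-- The product of two bounded definable functions is definable. -/
theorem HasDefinableBoundedMul.mul [Finite α] (hmul : HasDefinableBoundedMul L M) {S : Set (α → M)} (hS : Def L S)
    {f g : (α → M) → M} (hf : DefFun L f) (hg : DefFun L g) {a b : M}
    (hfb : ∀ x ∈ S, f x ∈ Ioo a b) (hgb : ∀ x ∈ S, g x ∈ Ioo a b) :
    DefFunOn L S fun v => f v * g v := by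
  have h1 : DefFun L fun p : Option α → M => f fun i => p (some i) :=
    hf.comp fun i => .proj (some i)
  have h2 : DefFun L fun p : Option α → M => g fun i => p (some i) :=
    hg.comp fun i => .proj (some i)
  have h3 := Def.comp (hmul a b) (g := ![fun p : Option α → M => f fun i => p (some i),
    fun p : Option α → M => g fun i => p (some i), fun p => p none])
    (by simp [Fin.forall_fin_succ, h1, h2, DefFun.proj])
  unfold DefFunOn
  convert Def.and (hS.preimage_comp some) h3 using 3 with p
  refine and_congr_right fun hp => ⟨fun h => ⟨hfb _ hp, hgb _ hp, h⟩, fun h => h.2.2⟩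

end Order

end Definability

/-! ### Definable compactness of closed bounded sets. -/

section Compactness

variable {L : FirstOrder.Language.{u, v}} {M : Type w} [L.Structure M]
  [Field M] [LinearOrder M] [IsStrictOrderedRing M]

/-- One coordinate of a point at which a bounded definable directed family accumulates. -/
theorem DefinablyComplete.exists_cluster_coord (hcomplete : DefinablyComplete L M)
    (hexp : ExpandsOrderedGroup L M) {n : ℕ} {D : M → M → Set (Fin n → M)}
    (hD : Def L {p : Fin 2 ⊕ Fin n → M | (fun i => p (Sum.inr i)) ∈ D (p (Sum.inl 0)) (p (Sum.inl 1))})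
    (hne : ∀ s ε, 0 < ε → (D s ε).Nonempty)
    (hanti : ∀ s s' ε ε', s ≤ s' → 0 < ε → ε ≤ ε' → D s' ε ⊆ D s ε')
    (i : Fin n) {r : M} (hr : ∀ s ε, 0 < ε → ∀ x ∈ D s ε, |x i| ≤ r) :
    ∃ b, ∀ s ε, 0 < ε → ∃ x ∈ D s ε, |x i - b| < ε := by
  -- The family shrinks as `s` grows and `ε` decreases; `sup Y` is the lower limit of the `i`-th
  -- coordinate along it.
  set Y : Set M := {y | ∃ t : Fin 2 → M, 0 < t 1 ∧ ∀ x : Fin n → M, x ∈ D (t 0) (t 1) → y ≤ x i}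
  have hYdef : Def₁ L Y := by
    refine Def.exists_tuple (P := fun (v : Fin 1 → M) (t : Fin 2 → M) =>
      0 < t 1 ∧ ∀ x : Fin n → M, x ∈ D (t 0) (t 1) → v 0 ≤ x i) ?_
    refine (hexp.lt (.const 0) (.proj (Sum.inr 1))).and ?_
    refine Def.forall_tuple (P := fun (p : Fin 1 ⊕ Fin 2 → M) (x : Fin n → M) =>
      x ∈ D (p (Sum.inr 0)) (p (Sum.inr 1)) → p (Sum.inl 0) ≤ x i) ?_
    refine Def.imp ?_ (hexp.le (.proj (Sum.inl (Sum.inl 0))) (.proj (Sum.inr i)))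
    exact hD.preimage_comp (Sum.map Sum.inr id)
  have hYne : Y.Nonempty :=
    ⟨-r, ![0, 1], by simp, fun x hx => (abs_le.1 (hr _ _ (by simp) x hx)).1⟩
  have hYbdd : BddAbove Y := by
    refine ⟨r, fun y ⟨t, ht, h⟩ => ?_⟩
    obtain ⟨x, hx⟩ := hne (t 0) (t 1) ht
    exact (h x hx).trans (abs_le.1 (hr _ _ ht x hx)).2
  obtain ⟨b, hb⟩ := (hcomplete Y hYdef hYne).1 hYbdd
  refine ⟨b, fun s ε hε => ?_⟩
  obtain ⟨y, ⟨t, ht, hy⟩, hby, -⟩ := hb.exists_between (sub_lt_self b hε)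
  by_contra! hcon
  -- Far enough along the family, `x i > b - ε` and `|x i - b| ≥ ε`, so `x i ≥ b + ε`, contradicting
  -- `b = sup Y`.
  have : b + ε ∈ Y := by
    refine ⟨![max s (t 0), min ε (t 1)], by simp [hε, ht], fun x hx => ?_⟩
    have hx' : x ∈ D (max s (t 0)) (min ε (t 1)) := hx
    have h1 := hcon x (hanti _ _ _ _ (le_max_left _ _) (lt_min hε ht) (min_le_left _ _) hx')
    have h2 := hy x (hanti _ _ _ _ (le_max_right _ _) (lt_min hε ht) (min_le_right _ _) hx')
    rcases le_abs.1 h1 with h | h <;> linarith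
  linarith [hb.1 this]

/-- A bounded definable directed family of nonempty sets accumulates at some point. -/
theorem DefinablyComplete.exists_cluster (hcomplete : DefinablyComplete L M)
    (hexp : ExpandsOrderedGroup L M) {n : ℕ} {D : M → M → Set (Fin n → M)}
    (hD : Def L {p : Fin 2 ⊕ Fin n → M | (fun i => p (Sum.inr i)) ∈ D (p (Sum.inl 0)) (p (Sum.inl 1))})
    (hne : ∀ s ε, 0 < ε → (D s ε).Nonempty)
    (hanti : ∀ s s' ε ε', s ≤ s' → 0 < ε → ε ≤ ε' → D s' ε ⊆ D s ε')
    {r : M} (hr : ∀ s ε, 0 < ε → ∀ x ∈ D s ε, ∀ i, |x i| ≤ r) :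
    ∃ a : Fin n → M, ∀ s ε, 0 < ε → ∃ x ∈ D s ε, ∀ i, |x i - a i| < ε := by
  suffices H : ∀ T : Finset (Fin n), ∃ a : Fin n → M, ∀ s ε, 0 < ε →
      ∃ x ∈ D s ε, ∀ i, i ∈ T → |x i - a i| < ε by simpa using H Finset.univ
  intro T
  induction T using Finset.induction_on with
  | empty => exact ⟨0, fun s ε hε => by simpa using! hne s ε hε⟩
  | insert j T hj ih =>
    obtain ⟨a, ha⟩ := ih
    -- Since `ε` is both an index and the precision, adding closeness in the coordinates of `T`
    -- keeps the family decreasing; induction supplies nonemptiness.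
    obtain ⟨b, hb⟩ := hcomplete.exists_cluster_coord hexp
      (D := fun s ε => {x | x ∈ D s ε ∧ ∀ i, i ∈ T → |x i - a i| < ε})
      (hD.and (Def.forall_finite fun i => (Def.of_prop _).imp
        (hexp.lt (hexp.abs (hexp.sub (.proj (Sum.inr i)) (.const _))) (.proj (Sum.inl 1)))))
      ha (fun s s' ε ε' hs h0 hε x hx =>
        ⟨hanti s s' ε ε' hs h0 hε hx.1, fun i hi => (hx.2 i hi).trans_le hε⟩)
      j (fun s ε hε x hx => hr s ε hε x hx.1 j)
    refine ⟨Function.update a j b, fun s ε hε => ?_⟩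
    obtain ⟨x, hx, hxj⟩ := hb s ε hε
    refine ⟨x, hx.1, fun i hi => ?_⟩
    rcases eq_or_ne i j with rfl | hij
    · simpa using hxj
    · simpa [hij] using hx.2 i (Finset.mem_of_mem_insert_of_ne hi hij)

variable [TopologicalSpace M] [OrderTopology M]

theorem exists_abs_sub_lt_subset_of_mem_nhds {ι : Type*} [Finite ι] {a : ι → M} {U : Set (ι → M)}
    (hU : U ∈ 𝓝 a) : ∃ ε > 0, ∀ x : ι → M, (∀ i, |x i - a i| < ε) → x ∈ U := by
  rw [nhds_pi, Filter.mem_pi'] at hU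
  obtain ⟨I, t, ht, htU⟩ := hU
  have h : ∀ i, ∀ᶠ ε in 𝓝[>] (0 : M), ∀ y, |y - a i| < ε → y ∈ t i := fun i => by
    obtain ⟨ε, hε, h⟩ := (nhds_basis_abs_sub_lt (a i)).mem_iff.1 (ht i)
    filter_upwards [Ioo_mem_nhdsGT hε] with δ hδ y hy
    exact h (hy.trans hδ.2)
  obtain ⟨ε, h1, h2⟩ := ((eventually_all.2 h).and self_mem_nhdsWithin).exists
  exact ⟨ε, h2, fun x hx => htU fun i _ => h1 i _ (hx i)⟩

/-- Definable compactness of closed bounded sets, for definable directed families of subsets. -/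
theorem DefinablyComplete.exists_frequently_mem (hcomplete : DefinablyComplete L M)
    (hexp : ExpandsOrderedGroup L M) {n : ℕ} {S : Set (Fin n → M)} (hSclosed : IsClosed S)
    {r : M} (hr : ∀ x ∈ S, ∀ i, |x i| ≤ r) {D : M → M → Set (Fin n → M)}
    (hD : Def L {p : Fin 2 ⊕ Fin n → M | (fun i => p (Sum.inr i)) ∈ D (p (Sum.inl 0)) (p (Sum.inl 1))})
    (hDS : ∀ s ε, D s ε ⊆ S) (hne : ∀ s ε, 0 < ε → (D s ε).Nonempty)
    (hanti : ∀ s s' ε ε', s ≤ s' → 0 < ε → ε ≤ ε' → D s' ε ⊆ D s ε') :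
    ∃ a ∈ S, ∀ s ε, 0 < ε → ∃ᶠ x in 𝓝[S] a, x ∈ D s ε := by
  obtain ⟨a, ha⟩ := hcomplete.exists_cluster hexp hD hne hanti
    fun s ε _ x hx => hr x (hDS s ε hx)
  have key : ∀ s ε, 0 < ε → ∀ U ∈ 𝓝 a, ∃ x ∈ D s ε, x ∈ U := fun s ε hε U hU => by
    obtain ⟨δ, hδ, h⟩ := exists_abs_sub_lt_subset_of_mem_nhds hU
    obtain ⟨x, hx, hxa⟩ := ha s (min ε δ) (lt_min hε hδ)
    exact ⟨x, hanti _ _ _ _ le_rfl (lt_min hε hδ) (min_le_left _ _) hx,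
      h x fun i => (hxa i).trans_le (min_le_right _ _)⟩
  refine ⟨a, ?_, fun s ε hε hcon => ?_⟩
  · rw [← hSclosed.closure_eq, mem_closure_iff_nhds]
    intro U hU
    obtain ⟨x, hx, hxU⟩ := key 0 1 one_pos U hU
    exact ⟨x, hxU, hDS _ _ hx⟩
  · obtain ⟨x, hx, hxU⟩ := key s ε hε _ (eventually_nhdsWithin_iff.1 hcon)
    exact hxU (hDS _ _ hx) hx

variable {n : ℕ} {S : Set (Fin n → M)} {F : (Fin n → M) → M} {r : M}

/-- A definable continuous function on a closed bounded definable set is bounded. -/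
theorem DefinablyComplete.exists_abs_le (hcomplete : DefinablyComplete L M)
    (hexp : ExpandsOrderedGroup L M) (hSdef : Def L S) (hSclosed : IsClosed S)
    (hr : ∀ x ∈ S, ∀ i, |x i| ≤ r) (hF : DefFun L F) (hFc : ContinuousOn F S) :
    ∃ R, ∀ x ∈ S, |F x| ≤ R := by
  by_contra! hcon
  obtain ⟨a, haS, ha⟩ := hcomplete.exists_frequently_mem hexp hSclosed hr
    (D := fun s _ => {x | x ∈ S ∧ s < |F x|})
    (Def.and (hSdef.preimage_comp Sum.inr)
      (hexp.lt (.proj (Sum.inl 0)) (hexp.abs (hF.comp fun i => .proj (Sum.inr i)))))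
    (fun _ _ _ hx => hx.1) (fun s _ _ => hcon s)
    (fun _ _ _ _ hs _ _ _ hx => ⟨hx.1, hs.trans_lt hx.2⟩)
  obtain ⟨x, hx, hx'⟩ := ((ha (|F a| + 1) 1 one_pos).and_eventually
    ((hFc a haS).abs.eventually_lt_const (lt_add_one _))).exists
  exact lt_asymm hx.2 hx'

/-- A positive definable continuous function on a closed bounded definable set is bounded away
from zero. -/
theorem DefinablyComplete.exists_pos_le (hcomplete : DefinablyComplete L M)
    (hexp : ExpandsOrderedGroup L M) (hSdef : Def L S) (hSclosed : IsClosed S)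
    (hr : ∀ x ∈ S, ∀ i, |x i| ≤ r) (hF : DefFun L F) (hFc : ContinuousOn F S)
    (hpos : ∀ x ∈ S, 0 < F x) : ∃ c, 0 < c ∧ ∀ x ∈ S, c ≤ F x := by
  by_contra! hcon
  obtain ⟨a, haS, ha⟩ := hcomplete.exists_frequently_mem hexp hSclosed hr
    (D := fun _ ε => {x | x ∈ S ∧ F x < ε})
    (Def.and (hSdef.preimage_comp Sum.inr)
      (hexp.lt (hF.comp fun i => .proj (Sum.inr i)) (.proj (Sum.inl 1))))
    (fun _ _ _ hx => hx.1) (fun _ ε hε => hcon ε hε)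
    (fun _ _ _ _ _ _ hε _ hx => ⟨hx.1, hx.2.trans_le hε⟩)
  have h2 : F a / 2 < F a := half_lt_self (hpos a haS)
  obtain ⟨x, hx, hx'⟩ := ((ha 0 (F a / 2) (half_pos (hpos a haS))).and_eventually
    ((hFc a haS).eventually_const_lt h2)).exists
  exact lt_asymm hx.2 hx'

end Compactness

/-! ### The comparison germ and the division lemma. -/

section Lojasiewicz

variable {L : FirstOrder.Language.{u, v}} {M : Type w} [L.Structure M]
  [Field M] [LinearOrder M] [IsStrictOrderedRing M]

theorem HasDefinableBoundedMul.mul_of_abs_le {α : Type} [Finite α]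
    (hmul : HasDefinableBoundedMul L M)
    {S : Set (α → M)} (hS : Def L S) {f g : (α → M) → M} (hf : DefFun L f) (hg : DefFun L g)
    {a b : M} (hfb : ∀ x ∈ S, |f x| ≤ a) (hgb : ∀ x ∈ S, |g x| ≤ b) :
    DefFunOn L S fun v => f v * g v := by
  refine hmul.mul (a := -(max a b + 1)) (b := max a b + 1) hS hf hg (fun x hx => ?_) fun x hx => ?_
  · exact abs_lt.1 (((hfb x hx).trans (le_max_left a b)).trans_lt (lt_add_one _))
  · exact abs_lt.1 (((hgb x hx).trans (le_max_right a b)).trans_lt (lt_add_one _))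

/-- Powers of bounded definable functions are definable. -/
theorem HasDefinableBoundedMul.exists_defFun_pow {α : Type} [Finite α]
    (hmul : HasDefinableBoundedMul L M)
    {S : Set (α → M)} (hS : Def L S) {f : (α → M) → M} (hf : DefFun L f) {a : M}
    (hfa : ∀ x ∈ S, |f x| ≤ a) (m : ℕ) :
    ∃ F : (α → M) → M, DefFun L F ∧ EqOn F (fun x => f x ^ m) S := by
  induction m with
  | zero => exact ⟨fun _ => 1, .const 1, fun x _ => by simp⟩
  | succ m ih =>
    obtain ⟨F, hF, hFS⟩ := ih
    have hFa : ∀ x ∈ S, |F x| ≤ a ^ m := fun x hx => by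
      rw [hFS hx, abs_pow]
      exact pow_le_pow_left₀ (abs_nonneg _) (hfa x hx) m
    obtain ⟨H, hH, hHS⟩ := (hmul.mul_of_abs_le hS hF hf hFa hfa).exists_defFun hS
    exact ⟨H, hH, fun x hx => by simp only [hHS hx, hFS hx, pow_succ]⟩

variable {n : ℕ} {S : Set (Fin n → M)} {f g : (Fin n → M) → M} {r : M}

/-- The largest `1`-Lipschitz function `v` of `|g|` with `v (|g x|) ≤ |f x|`. -/
theorem DefinablyComplete.exists_isGLB_max (hcomplete : DefinablyComplete L M)
    (hexp : ExpandsOrderedGroup L M) (hSdef : Def L S) (hSne : S.Nonempty)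
    (hf : DefFun L f) (hg : DefFun L g) :
    ∃ v : M → M, DefFun L (fun p : Fin 1 → M => v (p 0)) ∧
      ∀ t, IsGLB ((fun x => max |f x| (t - |g x|)) '' S) (v t) := by
  have key : ∀ t, ∃ y, IsGLB ((fun x => max |f x| (t - |g x|)) '' S) y := fun t => by
    refine (hcomplete _ ?_ (hSne.image _)).2 ⟨0, ?_⟩
    · refine Def.exists_tuple (P := fun (p : Fin 1 → M) (x : Fin n → M) =>
        x ∈ S ∧ max |f x| (t - |g x|) = p 0) ?_
      refine Def.and (hSdef.preimage_comp Sum.inr) (DefFun.eq ?_ (.proj (Sum.inl 0)))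
      exact (hexp.max (hexp.abs hf) (hexp.sub (.const t) (hexp.abs hg))).comp
        fun i => .proj (Sum.inr i)
    · rintro _ ⟨x, -, rfl⟩
      exact le_max_of_le_left (abs_nonneg _)
  choose v hv using key
  refine ⟨v, .of_graph ?_, hv⟩
  have hQ : ∀ {α : Type} (i : α), DefFun L fun p : α ⊕ Fin n → M =>
      max |f fun j => p (Sum.inr j)| (p (Sum.inl i) - |g fun j => p (Sum.inr j)|) := fun i =>
    hexp.max (hexp.abs (hf.comp fun j => .proj (Sum.inr j)))
      (hexp.sub (.proj (Sum.inl i)) (hexp.abs (hg.comp fun j => .proj (Sum.inr j))))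
  have hB : ∀ {α : Type} (i j : α), Def L {p : α → M |
      ∀ x : Fin n → M, x ∈ S → p j ≤ max |f x| (p i - |g x|)} := fun {α} i j =>
    Def.forall_tuple (P := fun (p : α → M) (x : Fin n → M) =>
      x ∈ S → p j ≤ max |f x| (p i - |g x|))
      (Def.imp (hSdef.preimage_comp Sum.inr) (hexp.le (.proj (Sum.inl j)) (hQ i)))
  -- The graph of `v` is described by a first-order formula: a lower bound that dominates every
  -- lower bound.
  have hG := (hB (some (0 : Fin 1)) none).and (Def.forall_elem
    (P := fun (p : Option (Fin 1) → M) z =>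
      (∀ x : Fin n → M, x ∈ S → z ≤ max |f x| (p (some 0) - |g x|)) → z ≤ p none)
    ((hB (Sum.inl (some 0)) (Sum.inr ())).imp
      (hexp.le (.proj (Sum.inr ())) (.proj (Sum.inl none)))))
  convert hG using 3 with p
  have hiff : IsGLB ((fun x => max |f x| (p (some 0) - |g x|)) '' S) (p none) ↔
      v (p (some 0)) = p none :=
    ⟨fun h => (hv _).unique h, fun h => h ▸ hv _⟩
  rw [← hiff]
  simp [IsGLB, IsGreatest, upperBounds, lowerBounds]

variable [TopologicalSpace M] [OrderTopology M]

/-- If `f = 0` implies `g = 0`, then `f` is bounded away from zero where `g` is. -/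
theorem DefinablyComplete.exists_pos_le_max (hcomplete : DefinablyComplete L M)
    (hexp : ExpandsOrderedGroup L M) (hSdef : Def L S) (hSclosed : IsClosed S)
    (hr : ∀ x ∈ S, ∀ i, |x i| ≤ r) (hf : DefFun L f) (hfc : ContinuousOn f S)
    (hg : DefFun L g) (hgc : ContinuousOn g S) (hzero : ∀ x ∈ S, f x = 0 → g x = 0)
    {t : M} (ht : 0 < t) : ∃ c, 0 < c ∧ ∀ x ∈ S, c ≤ max |f x| (t - |g x|) := by
  refine hcomplete.exists_pos_le hexp hSdef hSclosed hr
    (hexp.max (hexp.abs hf) (hexp.sub (.const t) (hexp.abs hg)))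
    (fun x hx => Tendsto.max (hfc.abs x hx) ((continuousOn_const.sub hgc.abs) x hx)) fun x hx => ?_
  rcases eq_or_ne (f x) 0 with h | h
  · simp [hzero x hx h, ht]
  · exact lt_max_of_lt_left (abs_pos.2 h)

/-- A definable increasing germ `u` with `u ∘ |g| ≤ |g| |f|`. -/
theorem DefinablyComplete.exists_germ (hcomplete : DefinablyComplete L M)
    (hexp : ExpandsOrderedGroup L M) (hmul : HasDefinableBoundedMul L M)
    (hSdef : Def L S) (hSclosed : IsClosed S) (hSne : S.Nonempty)
    (hr : ∀ x ∈ S, ∀ i, |x i| ≤ r) (hf : DefFun L f) (hfc : ContinuousOn f S)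
    (hg : DefFun L g) (hgc : ContinuousOn g S) (hzero : ∀ x ∈ S, f x = 0 → g x = 0) :
    ∃ u : M → M, IsDefIncreasingGerm L 1 u ∧ ∀ x ∈ S, u |g x| ≤ |g x| * |f x| := by
  obtain ⟨v, hvdef, hv⟩ := hcomplete.exists_isGLB_max hexp hSdef hSne hf hg
  have hle : ∀ t, ∀ x ∈ S, v t ≤ max |f x| (t - |g x|) := fun t x hx =>
    (hv t).1 (mem_image_of_mem _ hx)
  have hge : ∀ t c, (∀ x ∈ S, c ≤ max |f x| (t - |g x|)) → c ≤ v t := fun t c h =>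
    (hv t).2 (forall_mem_image.2 h)
  have hv0 : ∀ t, 0 ≤ v t := fun t => hge t 0 fun x _ => le_max_of_le_left (abs_nonneg _)
  have hvpos : ∀ t, 0 < t → 0 < v t := fun t ht => by
    obtain ⟨c, hc, h⟩ := hcomplete.exists_pos_le_max hexp hSdef hSclosed hr hf hfc hg hgc hzero ht
    exact hc.trans_le (hge t c h)
  have hvmono : Monotone v := fun s t hst => hge t _ fun x hx =>
    (hle s x hx).trans (max_le_max_left _ (sub_le_sub_right hst _))
  have hvlip : ∀ s t, v s - |t - s| ≤ v t := fun s t => hge t _ fun x hx => by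
    rw [sub_le_iff_le_add, ← max_add_add_right]
    refine (hle s x hx).trans (max_le_max ?_ ?_)
    · linarith [abs_nonneg (t - s)]
    · linarith [neg_abs_le (t - s)]
  have hvc : Continuous v := continuous_iff_continuousAt.2 fun s => by
    have hlim : Tendsto (fun t => |t - s|) (𝓝 s) (𝓝 0) := by
      have : Continuous fun t : M => |t - s| := by fun_prop
      simpa using this.tendsto s
    refine tendsto_of_tendsto_of_tendsto_of_le_of_le (g := fun t => v s - |t - s|)
      (h := fun t => v s + |t - s|) ?_ ?_ (fun t => hvlip s t) fun t => ?_
    · simpa using tendsto_const_nhds.sub hlim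
    · simpa using tendsto_const_nhds.add hlim
    · have := hvlip t s
      rw [abs_sub_comm] at this
      exact sub_le_iff_le_add.1 this
  -- The factor `t` makes the monotone `v` strictly increasing and yields the extra `|g|` that sends
  -- the quotient to `0` at zeros of `f`.
  refine ⟨fun t => t * v t, ⟨?_, (continuous_id.mul hvc).continuousOn, ?_, zero_mul _⟩, ?_⟩
  · have hI : Def L {p : Fin 1 → M | p 0 ∈ Icc 0 1} :=
      (hexp.le (.const 0) (.proj 0)).and (hexp.le (.proj 0) (.const 1))
    have := hmul.mul_of_abs_le hI (.proj 0) hvdef (a := 1) (b := v 1)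
      (fun p hp => by rw [abs_of_nonneg hp.1]; exact hp.2)
      fun p hp => by rw [abs_of_nonneg (hv0 _)]; exact hvmono hp.2
    exact this.preimage_comp fun o : Option (Fin 1) => o.elim 1 fun _ => 0
  · intro s hs t _ hst
    calc s * v s ≤ s * v t := mul_le_mul_of_nonneg_left (hvmono hst.le) hs.1
      _ < t * v t := mul_lt_mul_of_pos_right hst (hvpos t (hs.1.trans_lt hst))
  · intro x hx
    refine mul_le_mul_of_nonneg_left ?_ (abs_nonneg _)
    -- At `t = |g x|` the second term of the maximum vanishes.
    simpa using hle |g x| x hx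

/-- Division of `k` by `f` when `|k| ≤ |g| |f|` near the zeros of `g`. -/
theorem DefinablyComplete.exists_quotient (hcomplete : DefinablyComplete L M)
    (hexp : ExpandsOrderedGroup L M) (hmul : HasDefinableBoundedMul L M)
    (hSdef : Def L S) (hSclosed : IsClosed S)
    (hr : ∀ x ∈ S, ∀ i, |x i| ≤ r) (hf : DefFun L f) (hfc : ContinuousOn f S)
    (hg : DefFun L g) (hgc : ContinuousOn g S) (hzero : ∀ x ∈ S, f x = 0 → g x = 0)
    {k : (Fin n → M) → M} (hk : DefFun L k) (hkc : ContinuousOn k S) {δ : M} (hδ : 0 < δ)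
    (hkg : ∀ x ∈ S, |g x| < δ → |k x| ≤ |g x| * |f x|) :
    ∃ h : (Fin n → M) → M, DefFunOn L S h ∧ ContinuousOn h S ∧ ∀ x ∈ S, k x = h x * f x := by
  have hk0 : ∀ x ∈ S, f x = 0 → k x = 0 := fun x hx h => by
    simpa [hzero x hx h, hδ] using hkg x hx
  have hsmall : ∀ x ∈ S, |g x| < δ → |k x / f x| ≤ |g x| := fun x hx h => by
    rcases eq_or_ne (f x) 0 with h0 | h0
    · simp [h0]
    · rw [abs_div, div_le_iff₀ (abs_pos.2 h0)]
      exact hkg x hx h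
  have heq : ∀ x ∈ S, k x = k x / f x * f x := fun x hx => by
    rcases eq_or_ne (f x) 0 with h0 | h0
    · simp [h0, hk0 x hx h0]
    · rw [div_mul_cancel₀ _ h0]
  obtain ⟨c, hc, hcf⟩ :=
    hcomplete.exists_pos_le_max hexp hSdef hSclosed hr hf hfc hg hgc hzero hδ
  obtain ⟨A, hA⟩ := hcomplete.exists_abs_le hexp hSdef hSclosed hr hf hfc
  obtain ⟨B, hB⟩ := hcomplete.exists_abs_le hexp hSdef hSclosed hr hk hkc
  -- Where `|g| ≥ δ`, the maximum bounded below by `c` must be attained by `|f|`.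
  have hbdd : ∀ x ∈ S, |k x / f x| ≤ max δ (B / c) := fun x hx => by
    rcases lt_or_ge |g x| δ with h | h
    · exact le_max_of_le_left ((hsmall x hx h).trans h.le)
    · have hcx : c ≤ |f x| := by
        rcases le_max_iff.1 (hcf x hx) with h' | h'
        · exact h'
        · linarith
      rw [abs_div]
      exact le_max_of_le_right (div_le_div₀ ((abs_nonneg _).trans (hB x hx)) (hB x hx) hc hcx)
  refine ⟨fun x => k x / f x, ?_, fun x hx => ?_, heq⟩
  · set R := max A (max δ (B / c)) + 1
    have hl : ∀ {F : (Fin n → M) → M}, DefFun L F →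
        DefFun L fun p : Option (Fin n) → M => F fun i => p (some i) := fun hF =>
      hF.comp fun i => .proj (some i)
    -- The graph of `k / f` is cut out by `y * f = k` with both factors in `(-R, R)`; `h4` adds `y =
    -- 0` where `f = 0`, matching division by zero.
    have h3 := Def.comp (hmul (-R) R) (g := ![fun p : Option (Fin n) → M => p none,
      fun p => f fun i => p (some i), fun p => k fun i => p (some i)])
      (by simp [Fin.forall_fin_succ, hl hf, hl hk, DefFun.proj])
    have h4 := (Def.and (hSdef.preimage_comp some) h3).and
      (((hl hf).eq (.const 0)).imp ((DefFun.proj (none : Option (Fin n))).eq (.const 0)))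
    unfold DefFunOn
    convert h4 using 3 with p
    constructor
    · rintro ⟨hp, h⟩
      dsimp only at h
      refine ⟨⟨hp, ?_, abs_lt.1 ?_, ?_⟩, fun h0 => ?_⟩
      · change p none ∈ _
        rw [← h]
        exact abs_lt.1 (((hbdd _ hp).trans (le_max_right A _)).trans_lt (lt_add_one _))
      · exact ((hA _ hp).trans (le_max_left A _)).trans_lt (lt_add_one _)
      · change p none * f (fun i => p (some i)) = k fun i => p (some i)
        rw [← h, ← heq _ hp]
      · rw [← h, h0, div_zero]
    · rintro ⟨⟨hp, -, -, h⟩, h0⟩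
      refine ⟨hp, ?_⟩
      dsimp only
      change p none * f (fun i => p (some i)) = k fun i => p (some i) at h
      by_cases hf0 : f (fun i => p (some i)) = 0
      · rw [hf0, div_zero, h0 hf0]
      · rw [← h, mul_div_cancel_right₀ _ hf0]
  · by_cases h0 : f x = 0
    · have hg0 : Tendsto (fun y => |g y|) (𝓝[S] x) (𝓝 0) := by
        simpa [hzero x hx h0] using! Tendsto.abs (hgc x hx)
      have : Tendsto (fun y => k y / f y) (𝓝[S] x) (𝓝 0) := by
        rw [tendsto_zero_iff_abs_tendsto_zero]
        refine tendsto_of_tendsto_of_tendsto_of_le_of_le' tendsto_const_nhds hg0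
          (.of_forall fun y => abs_nonneg _) ?_
        filter_upwards [hg0.eventually_lt_const hδ, self_mem_nhdsWithin] with y hy hyS
        exact hsmall y hyS hy
      simpa [ContinuousWithinAt, h0] using this
    · exact (hkc x hx).div (hfc x hx) h0

end Lojasiewicz

end BddMul

/-! ### The theorem, by choosing a minorant of the germ. -/

theorem mainTheorem7 (L : FirstOrder.Language.{u, v}) (M : Type w) [L.Structure M]
    [Field M] [LinearOrder M] [IsStrictOrderedRing M] [TopologicalSpace M] [OrderTopology M]
    (hexp : BddMul.ExpandsOrderedGroup L M)
    (hmul : BddMul.HasDefinableBoundedMul L M)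
    (hcomplete : BddMul.DefinablyComplete L M)
    (homin : BddMul.LocallyOMinimal L M)
    (Φ : Subgroup (Equiv.Perm M)) (hΦ : BddMul.IsAdmissible L Φ)
    (n : ℕ) (S : Set (Fin n → M))
    (hSdef : BddMul.Def L S) (hSclosed : IsClosed S)
    (hSbdd : ∃ r : M, ∀ x ∈ S, ∀ i, |x i| ≤ r)
    (f g : (Fin n → M) → M)
    (hfdef : BddMul.DefFunOn L S f) (hfcont : ContinuousOn f S)
    (hgdef : BddMul.DefFunOn L S g) (hgcont : ContinuousOn g S)
    (hzero : ∀ x ∈ S, f x = 0 → g x = 0) :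
    (∃ φ ∈ Φ, ∃ h : (Fin n → M) → M, BddMul.DefFunOn L S h ∧ ContinuousOn h S ∧
      ∀ x ∈ S, φ (g x) = h x * f x) ∧
    (BddMul.PolynomiallyBounded L M →
      ∃ m : ℕ, 0 < m ∧ ∃ h : (Fin n → M) → M, BddMul.DefFunOn L S h ∧ ContinuousOn h S ∧
        ∀ x ∈ S, g x ^ m = h x * f x) := by
  obtain ⟨r, hr⟩ := hSbdd
  obtain ⟨F, hF, hFf⟩ := hfdef.exists_defFun hSdef
  obtain ⟨G, hG, hGg⟩ := hgdef.exists_defFun hSdef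
  have hFc : ContinuousOn F S := hfcont.congr hFf
  have hGc : ContinuousOn G S := hgcont.congr hGg
  have hFG : ∀ x ∈ S, F x = 0 → G x = 0 := fun x hx h => by
    rw [hGg hx]
    exact hzero x hx (hFf hx ▸ h)
  -- The infimum defining `v` needs `S` nonempty.
  rcases S.eq_empty_or_nonempty with rfl | hSne
  · have h0 : BddMul.DefFunOn L (∅ : Set (Fin n → M)) fun _ => 0 :=
      (BddMul.DefFun.const 0).defFunOn hSdef
    exact ⟨⟨1, Φ.one_mem, _, h0, continuousOn_empty _, by simp⟩,
      fun _ => ⟨1, one_pos, _, h0, continuousOn_empty _, by simp⟩⟩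
  obtain ⟨u, hu, huG⟩ :=
    hcomplete.exists_germ hexp hmul hSdef hSclosed hSne hr hF hFc hG hGc hFG
  constructor
  · obtain ⟨-, -, φ, hφ, -, hφu⟩ := hΦ.bounds 1 one_pos u hu
    obtain ⟨hodd, hmono, hφ0, hφdef⟩ := hΦ.subset hφ
    obtain ⟨δ, hδ, hδu⟩ := mem_nhdsGT_iff_exists_Ioo_subset.1 hφu
    -- Oddness reduces the estimate of `|φ (g x)|` to the one-sided germ at `0`.
    have habs : ∀ t, |φ t| = φ |t| := fun t => by
      rcases le_total 0 t with ht | ht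
      · rw [abs_of_nonneg ht, abs_of_nonneg (hφ0 ▸ hmono.monotone ht)]
      · rw [abs_of_nonpos ht, hodd, abs_of_nonpos (hφ0 ▸ hmono.monotone ht)]
    have hφc : Continuous φ := hmono.monotone.continuous_of_surjective φ.surjective
    obtain ⟨h, h1, h2, h3⟩ := hcomplete.exists_quotient hexp hmul hSdef hSclosed hr hF hFc hG hGc
      hFG (hφdef.defFun hG) (hφc.comp_continuousOn hGc) hδ fun x hx hxδ => by
        rw [habs]
        -- The germ inequality holds only for `0 < t < δ`, so zeros of `G` are separate.
        rcases eq_or_ne (G x) 0 with h0 | h0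
        · simp [h0, hφ0]
        · exact (hδu ⟨abs_pos.2 h0, hxδ⟩).trans (huG x hx)
    exact ⟨φ, hφ, h, h1, h2, fun x hx => by rw [← hGg hx, ← hFf hx]; exact h3 x hx⟩
  · intro hpoly
    obtain ⟨m, hm, hmu⟩ := hpoly 1 one_pos u hu
    obtain ⟨δ, hδ, hδu⟩ := mem_nhdsGT_iff_exists_Ioo_subset.1 hmu
    obtain ⟨R, hR⟩ := hcomplete.exists_abs_le hexp hSdef hSclosed hr hG hGc
    obtain ⟨K, hK, hKG⟩ := hmul.exists_defFun_pow hSdef hG hR m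
    obtain ⟨h, h1, h2, h3⟩ := hcomplete.exists_quotient hexp hmul hSdef hSclosed hr hF hFc hG hGc
      hFG hK ((hGc.pow m).congr hKG) hδ fun x hx hxδ => by
        rw [hKG hx, abs_pow]
        rcases eq_or_ne (G x) 0 with h0 | h0
        · simp [h0, hm.ne']
        · exact (hδu ⟨abs_pos.2 h0, hxδ⟩).trans (huG x hx)
    exact ⟨m, hm, h, h1, h2, fun x hx => by
      rw [← hGg hx, ← hFf hx, ← h3 x hx]
      exact (hKG hx).symm⟩
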